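/- Let $n\ge 3$ be an odd prime power and let $F=\mathbb F_{n^2}$. Let $H\in M_3(F)$ be invertible and Hermitian, i.e. $H_{ij}^{\,n}=H_{ji}$ for all $i,j$, with associated Hermitian form $h(v,w)=\sum_{i,j}v_i^{\,n}H_{ij}w_j$ on $F^3$ (equivalently, with associated non-degenerate unitary polarity of the projective plane $\mathrm{PG}(2,n^2)$). Let $\Omega$ be the Hermitian unital, i.e. the set of points $\langle v\rangle$ of $\mathrm{PG}(2,n^2)$ with $h(v,v)=0$, and let $\mathrm{PSU}(3,n)$ be the image in $\mathrm{PGL}(3,n^2)$ of the group of all $A\in\mathrm{SL}(3,n^2)$ that preserve $h$, acting on the points of $\mathrm{PG}(2,n^2)$. Let $U$ be a cyclic subgroup of $\mathrm{PSU}(3,n)$ in which no non-trivial element fixes a point of $\Omega$. Then $|U|$ divides $\tfrac12(n+1)$ or $|U|$ divides $(n^2-n+1)/\gcd(3,n+1)$. -/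

import Mathlib

open scoped MatrixGroups LinearAlgebra.Projectivization

/-- The sesquilinear form `(v, w) ↦ ∑ i j, v i ^ n * H i j * w j` on `F³` attached to a
`3 × 3` matrix `H`. In the intended use `F` has `n ^ 2` elements, so that `x ↦ x ^ n` is the
involutory field automorphism of `F`. -/
def hermForm {F : Type*} [Field F] (n : ℕ) (H : Matrix (Fin 3) (Fin 3) F)
    (v w : Fin 3 → F) : F :=
  ∑ i, ∑ j, v i ^ n * H i j * w j

/-- `H` is a non-degenerate Hermitian matrix with respect to `x ↦ x ^ n`. Over a field with
`n ^ 2` elements such matrices are, up to scalars, the matrices of the non-degenerate unitary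
polarities of the projective plane `PG(2, n ^ 2)`: the polarity sends the point spanned by `v`
to the line `{w | hermForm n H v w = 0}`. -/
structure IsNondegHermitian {F : Type*} [Field F] (n : ℕ) (H : Matrix (Fin 3) (Fin 3) F) :
    Prop where
  conj_apply : ∀ i j, H i j ^ n = H j i
  isUnit_det : IsUnit H.det

/-- The Hermitian unital: the set of points of `PG(2, n ^ 2)` that lie on their own polar line. -/
def unital {F : Type*} [Field F] (n : ℕ) (H : Matrix (Fin 3) (Fin 3) F) :
    Set (ℙ F (Fin 3 → F)) :=
  {P | hermForm n H P.rep P.rep = 0}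

/-- Membership in the unital does not depend on the vector that represents the point. -/
theorem mk_mem_unital {F : Type*} [Field F] (n : ℕ) (H : Matrix (Fin 3) (Fin 3) F)
    (v : Fin 3 → F) (hv : v ≠ 0) :
    Projectivization.mk F v hv ∈ unital n H ↔ hermForm n H v v = 0 := by
  obtain ⟨a, ha⟩ := Projectivization.exists_smul_eq_mk_rep F v hv
  have key : hermForm n H (a • v) (a • v) = ((a : F) ^ n * a) * hermForm n H v v := by
    simp only [hermForm, Finset.mul_sum, Pi.smul_apply, Units.smul_def, smul_eq_mul]
    refine Finset.sum_congr rfl fun i _ => Finset.sum_congr rfl fun j _ => ?_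
    ring
  change hermForm n H _ _ = 0 ↔ _
  rw [← ha, key]
  simp

/-- The special unitary group `SU(3, n)`: the matrices of determinant one that preserve the
Hermitian form given by `H`. -/
def specialUnitary {F : Type*} [Field F] (n : ℕ) (H : Matrix (Fin 3) (Fin 3) F) :
    Subgroup SL(3, F) where
  carrier := {A | ∀ v w : Fin 3 → F,
    hermForm n H (A.1.mulVec v) (A.1.mulVec w) = hermForm n H v w}
  one_mem' := by
    intro v w
    simp
  mul_mem' := by
    intro A B hA hB v w
    have h := hA (B.1.mulVec v) (B.1.mulVec w)
    rw [hB v w] at h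
    simpa [Matrix.mulVec_mulVec] using h
  inv_mem' := by
    intro A hA v w
    have e : ∀ x : Fin 3 → F, A.1.mulVec ((A⁻¹).1.mulVec x) = x := by
      intro x
      rw [Matrix.mulVec_mulVec, ← Matrix.SpecialLinearGroup.coe_mul, mul_inv_cancel,
        Matrix.SpecialLinearGroup.coe_one, Matrix.one_mulVec]
    have h := hA ((A⁻¹).1.mulVec v) ((A⁻¹).1.mulVec w)
    rw [e, e] at h
    exact h.symm

/-- The projective special unitary group `PSU(3, n)`: the image of `SU(3, n)` in the group
`PGL(3, n ^ 2)` of projectivities of the plane. -/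
def projSpecialUnitary {F : Type*} [Field F] (n : ℕ) (H : Matrix (Fin 3) (Fin 3) F) :
    Subgroup PGL(Fin 3, F) :=
  (specialUnitary n H).map Matrix.SpecialLinearGroup.toPGL

/-! Lift a generator `g` of `U` to `A` in SU(3, n). Fixed points of `g ^ k` are eigenvectors of `A ^
k`, so no such eigenvector is isotropic while `g ^ k ≠ 1`. Unitarity makes the eigenvalues in an
algebraic closure stable under φ : x ↦ x^(-n), and φ² is the Frobenius map of `F`.

If an eigenvalue x lies outside `F`, the eigenvalues are x, φx, φ²x. Determinant one gives
x^(n²-n+1) = 1, and with e = (n²-n+1)/gcd(3, n+1) the power x^e is fixed by φ. All eigenvalues then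
share their e-th power, and `A ^ e` is scalar.

Otherwise all eigenvalues lie in `F`. A repeated one would give an eigenspace of dimension at least
2, which contains isotropic vectors, or a Jordan block, whose eigenvector is isotropic. So they are
distinct, of norm one, and the order of `g` divides n+1. The order is odd: an involution in PSU(3,
n) coming from a power of `g` would again have an eigenspace of dimension at least 2. Since n+1 is
even, the order divides (n+1)/2. -/

/-! ### Conjugation and norm for the quadratic extension -/

/-- Over a field extension of a field with `n ^ 2` elements, `x ↦ x ^ n` is a ring homomorphism. -/
theorem exists_ringHom_apply_eq_pow {F : Type*} [Field F] [Finite F] {n : ℕ}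
    (hF : Nat.card F = n ^ 2) (K : Type*) [Field K] [Algebra F K] :
    ∃ σ : K →+* K, ∀ x, σ x = x ^ n := by
  have := Fintype.ofFinite F
  obtain ⟨p, hp⟩ := CharP.exists F
  obtain ⟨k, hpp, hk⟩ := FiniteField.card F p
  rw [← Nat.card_eq_fintype_card, hF] at hk
  obtain ⟨r, -, rfl⟩ := (Nat.dvd_prime_pow hpp).1 (hk ▸ dvd_pow_self n two_ne_zero)
  have := Fact.mk hpp
  have : CharP K p := charP_of_injective_algebraMap (algebraMap F K).injective p
  exact ⟨iterateFrobenius K p r, fun x => iterateFrobenius_def p r x⟩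

theorem pow_pow_eq_self_of_card {F : Type*} [Field F] [Finite F] {n : ℕ}
    (hF : Nat.card F = n ^ 2) (x : F) : (x ^ n) ^ n = x := by
  have := Fintype.ofFinite F
  rw [← pow_mul, ← sq, ← hF, Nat.card_eq_fintype_card, FiniteField.pow_card]

/-- An element of an extension of `F` that is fixed by `x ↦ x ^ |F|` lies in `F`. -/
theorem mem_range_algebraMap_of_pow_card_eq {F : Type*} [Field F] [Finite F] {n : ℕ} (hn : 1 < n)
    (hF : Nat.card F = n ^ 2) {K : Type*} [Field K] [Algebra F K] {x : K} (hx : (x ^ n) ^ n = x) :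
    ∃ a : F, algebraMap F K a = x := by
  classical
  have := Fintype.ofFinite F
  have h1 : 1 < n ^ 2 := Nat.one_lt_pow two_ne_zero hn
  have hne : (Polynomial.X ^ n ^ 2 - Polynomial.X : Polynomial K) ≠ 0 :=
    FiniteField.X_pow_card_sub_X_ne_zero K h1
  by_contra! hc
  -- The n² elements of `F` already exhaust the possible roots of X^(n²) - X; `x` would be one more.
  have hs : insert x (Finset.univ.image (algebraMap F K)) ⊆
      (Polynomial.X ^ n ^ 2 - Polynomial.X : Polynomial K).roots.toFinset := by
    intro y hy
    rw [Multiset.mem_toFinset, Polynomial.mem_roots hne]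
    simp only [Finset.mem_insert, Finset.mem_image, Finset.mem_univ, true_and] at hy
    simp only [Polynomial.IsRoot.def, Polynomial.eval_sub, Polynomial.eval_pow, Polynomial.eval_X,
      sub_eq_zero]
    rw [sq, pow_mul]
    rcases hy with rfl | ⟨a, rfl⟩
    · exact hx
    · rw [← map_pow, ← map_pow, pow_pow_eq_self_of_card hF]
  have h2 := (Finset.card_le_card hs).trans ((Multiset.toFinset_card_le _).trans
    (Polynomial.card_roots' _))
  rw [FiniteField.X_pow_card_sub_X_natDegree_eq K h1,
    Finset.card_insert_of_notMem (by simpa using hc),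
    Finset.card_image_of_injective _ (algebraMap F K).injective, Finset.card_univ,
    ← Nat.card_eq_fintype_card, hF] at h2
  omega

/-- The norm map of the quadratic extension is surjective. -/
theorem exists_pow_succ_eq_of_pow_eq {F : Type*} [Field F] [Finite F] {n : ℕ} (hn : 1 < n)
    (hF : Nat.card F = n ^ 2) {y : F} (hy : y ^ n = y) : ∃ x : F, x ^ (n + 1) = y := by
  rcases eq_or_ne y 0 with rfl | hy0
  · exact ⟨0, by simp⟩
  have := Fintype.ofFinite F
  obtain ⟨g, hg⟩ := IsCyclic.exists_generator (α := Fˣ)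
  have ho : orderOf g = (n - 1) * (n + 1) := by
    rw [orderOf_eq_card_of_forall_mem_zpowers hg, Nat.card_units, hF, mul_comm, ← Nat.sq_sub_sq,
      one_pow]
  obtain ⟨i, hi⟩ := (Submonoid.mem_powers_iff _ _).1
    (mem_powers_iff_mem_zpowers.2 (hg (Units.mk0 y hy0)))
  -- Since y^(n-1) = 1 and `g` has order (n-1)(n+1), the exponent of y = g^i is a multiple of n+1.
  have h1 : (Units.mk0 y hy0) ^ (n - 1) = 1 := by
    ext
    have h : y ^ (n - 1) * y = 1 * y := by
      rw [← pow_succ, Nat.sub_add_cancel hn.le, hy, one_mul]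
    simpa using mul_right_cancel₀ hy0 h
  rw [← hi, ← pow_mul, ← orderOf_dvd_iff_pow_eq_one, ho, mul_comm i] at h1
  obtain ⟨j, rfl⟩ := Nat.dvd_of_mul_dvd_mul_left (by omega) h1
  refine ⟨(g ^ j : Fˣ), ?_⟩
  rw [← Units.val_pow_eq_pow_val, ← pow_mul, mul_comm, hi, Units.val_mk0]

/-! ### Isotropic vectors and spectra of unitary matrices -/

section HermForm

variable {F : Type*} [Field F] {n : ℕ} {H : Matrix (Fin 3) (Fin 3) F}

theorem hermForm_add_right (u v w : Fin 3 → F) :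
    hermForm n H u (v + w) = hermForm n H u v + hermForm n H u w := by
  simp [hermForm, mul_add, Finset.sum_add_distrib]

theorem hermForm_smul_right (c : F) (u v : Fin 3 → F) :
    hermForm n H u (c • v) = c * hermForm n H u v := by
  simp only [hermForm, Finset.mul_sum, Pi.smul_apply, smul_eq_mul]
  exact Finset.sum_congr rfl fun i _ => Finset.sum_congr rfl fun j _ => by ring

theorem hermForm_smul_left (c : F) (u v : Fin 3 → F) :
    hermForm n H (c • u) v = c ^ n * hermForm n H u v := by
  simp only [hermForm, Finset.mul_sum, Pi.smul_apply, smul_eq_mul]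
  exact Finset.sum_congr rfl fun i _ => Finset.sum_congr rfl fun j _ => by ring

theorem hermForm_pow [Finite F] (hF : Nat.card F = n ^ 2) (hH : IsNondegHermitian n H)
    (u v : Fin 3 → F) : hermForm n H u v ^ n = hermForm n H v u := by
  obtain ⟨σ, hσ⟩ := exists_ringHom_apply_eq_pow hF F
  rw [← hσ]
  simp only [hermForm, map_sum, map_mul]
  rw [Finset.sum_comm]
  refine Finset.sum_congr rfl fun i _ => Finset.sum_congr rfl fun j _ => ?_
  simp only [hσ, hH.conj_apply, pow_pow_eq_self_of_card hF]
  ring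

theorem hermForm_add_left [Finite F] (hF : Nat.card F = n ^ 2) (u v w : Fin 3 → F) :
    hermForm n H (u + v) w = hermForm n H u w + hermForm n H v w := by
  obtain ⟨σ, hσ⟩ := exists_ringHom_apply_eq_pow hF F
  simp [hermForm, ← hσ, add_mul, Finset.sum_add_distrib]

/-- Every plane of `F³` contains a non-zero isotropic vector. -/
theorem exists_hermForm_self_eq_zero [Finite F] (hn : 1 < n) (hF : Nat.card F = n ^ 2)
    (hH : IsNondegHermitian n H) (W : Submodule F (Fin 3 → F)) (hW : 2 ≤ Module.finrank F W) :
    ∃ v ∈ W, v ≠ 0 ∧ hermForm n H v v = 0 := by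
  obtain ⟨f, hf⟩ := exists_linearIndependent_of_le_finrank hW
  have hf' : LinearIndependent F ![(f 0 : Fin 3 → F), (f 1 : Fin 3 → F)] := by
    have := hf.map' W.subtype W.ker_subtype
    convert! this using 1
    ext i : 1
    fin_cases i <;> rfl
  rw [LinearIndependent.pair_iff] at hf'
  generalize hu : (f 0 : Fin 3 → F) = u at hf'
  generalize hw : (f 1 : Fin 3 → F) = w at hf'
  have huW : u ∈ W := hu ▸ (f 0).2
  have hwW : w ∈ W := hw ▸ (f 1).2
  have key : ∀ x y : F, x • u + y • w = 0 → y = 0 := fun x y h => (hf' x y h).2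
  have hu0 : u ≠ 0 := fun h => one_ne_zero (hf' 1 0 (by simp [h])).1
  clear hf' hu hw
  by_cases hα : hermForm n H u u = 0
  · exact ⟨u, huW, hu0, hα⟩
  -- Gram–Schmidt: replacing w by w' orthogonal to u turns h(xu + w', xu + w') = 0 into a norm
  -- equation for x.
  obtain ⟨c, hc⟩ : ∃ c : F, hermForm n H u (c • u + w) = 0 :=
    ⟨-hermForm n H u w / hermForm n H u u, by
      rw [hermForm_add_right, hermForm_smul_right]; field_simp; ring⟩
  have hc' : hermForm n H (c • u + w) u = 0 := by
    rw [← hermForm_pow hF hH, hc, zero_pow (by omega)]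
  set w' := c • u + w with hw'
  obtain ⟨x, hx⟩ := exists_pow_succ_eq_of_pow_eq hn hF
    (y := -hermForm n H w' w' / hermForm n H u u) (by
      obtain ⟨σ, hσ⟩ := exists_ringHom_apply_eq_pow hF F
      rw [← hσ, map_div₀, map_neg, hσ, hσ, hermForm_pow hF hH, hermForm_pow hF hH])
  refine ⟨x • u + w', W.add_mem (W.smul_mem _ huW) (W.add_mem (W.smul_mem _ huW) hwW), ?_, ?_⟩
  · intro h
    refine one_ne_zero (key (x + c) 1 ?_)
    rw [← h, hw']
    module
  · clear_value w'
    rw [hermForm_add_right, hermForm_add_left hF, hermForm_add_left hF, hermForm_smul_right,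
      hermForm_smul_right, hermForm_smul_left, hermForm_smul_left, hc, hc']
    rw [pow_succ, eq_div_iff hα] at hx
    linear_combination hx

/-- A matrix annihilated by a quadratic polynomial with roots in `F` has an isotropic
eigenvector. -/
theorem exists_isotropic_eigenvector [Finite F] (hn : 1 < n) (hF : Nat.card F = n ^ 2)
    (hH : IsNondegHermitian n H) (B : Matrix (Fin 3) (Fin 3) F) (a b : F)
    (hB : (B - Matrix.scalar _ a) * (B - Matrix.scalar _ b) = 0) :
    ∃ v ≠ 0, hermForm n H v v = 0 ∧ ∃ c : F, B.mulVec v = c • v := by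
  have ker : ∀ c : F, 2 ≤ Module.finrank F (LinearMap.ker (B - Matrix.scalar _ c).mulVecLin) →
      ∃ v ≠ 0, hermForm n H v v = 0 ∧ ∃ c : F, B.mulVec v = c • v := by
    intro c hc
    obtain ⟨v, hv, hv0, hvv⟩ := exists_hermForm_self_eq_zero hn hF hH _ hc
    refine ⟨v, hv0, hvv, c, ?_⟩
    simpa [Matrix.sub_mulVec, sub_eq_zero, Matrix.smul_mulVec, ← Matrix.smul_one_eq_diagonal]
      using hv
  by_cases ha : 2 ≤ Module.finrank F (LinearMap.ker (B - Matrix.scalar _ a).mulVecLin)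
  · exact ker a ha
  refine ker b ?_
  -- By rank-nullity the two kernels have dimensions adding up to at least 3.
  have h1 : LinearMap.range (B - Matrix.scalar _ b).mulVecLin ≤
      LinearMap.ker (B - Matrix.scalar _ a).mulVecLin := by
    rintro _ ⟨v, rfl⟩
    simp only [LinearMap.mem_ker, Matrix.mulVecLin_apply, Matrix.mulVec_mulVec, hB,
      Matrix.zero_mulVec]
  have h2 := Submodule.finrank_mono h1
  have h3 := LinearMap.finrank_range_add_finrank_ker (B - Matrix.scalar _ b).mulVecLin
  simp only [Module.finrank_fintype_fun_eq_card, Fintype.card_fin] at h3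
  omega

/-- The eigenvalues of non-isotropic eigenvectors of a unitary matrix have norm one. -/
theorem eigenvalue_pow_succ_eq_one {A : Matrix (Fin 3) (Fin 3) F}
    (hA : ∀ v w : Fin 3 → F, hermForm n H (A.mulVec v) (A.mulVec w) = hermForm n H v w)
    {v : Fin 3 → F} (hv : hermForm n H v v ≠ 0) {c : F} (hc : A.mulVec v = c • v) :
    c ^ (n + 1) = 1 := by
  have h := hA v v
  rw [hc, hermForm_smul_left, hermForm_smul_right] at h
  exact mul_right_cancel₀ hv (by rw [pow_succ, mul_assoc, h, one_mul])

/-- A unitary matrix without isotropic eigenvectors has no Jordan blocks of size two. -/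
theorem sub_scalar_mulVec_eq_zero {A : Matrix (Fin 3) (Fin 3) F}
    (hA : ∀ v w : Fin 3 → F, hermForm n H (A.mulVec v) (A.mulVec w) = hermForm n H v w)
    (hiso : ∀ v ≠ 0, ∀ c : F, A.mulVec v = c • v → hermForm n H v v ≠ 0) {a : F} {u : Fin 3 → F}
    (hu : (A - Matrix.scalar _ a).mulVec ((A - Matrix.scalar _ a).mulVec u) = 0) :
    (A - Matrix.scalar _ a).mulVec u = 0 := by
  have hs : ∀ x : Fin 3 → F, (A - Matrix.scalar _ a).mulVec x = A.mulVec x - a • x := by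
    intro x
    simp [Matrix.sub_mulVec, Matrix.smul_mulVec, ← Matrix.smul_one_eq_diagonal]
  by_contra hv
  rw [hs u] at hu hv
  set v := A.mulVec u - a • u with hvdef
  have hAv : A.mulVec v = a • v := by rwa [hs, sub_eq_zero] at hu
  have hAu : A.mulVec u = v + a • u := by rw [hvdef]; module
  have hvv := hiso v hv a hAv
  have ha := eigenvalue_pow_succ_eq_one hA hvv hAv
  clear_value v
  -- Invariance reads h(v,u) = a^n (h(v,v) + a h(v,u)); as a^(n+1) = 1, this leaves a^n h(v,v) = 0.
  have h := hA v u
  rw [hAv, hAu, hermForm_smul_left, hermForm_add_right, hermForm_smul_right] at h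
  have han : a ^ n ≠ 0 := by
    intro h0
    rw [pow_succ, h0, zero_mul] at ha
    exact zero_ne_one ha
  refine hvv ((mul_eq_zero.1 (?_ : a ^ n * hermForm n H v v = 0)).resolve_left han)
  rw [pow_succ] at ha
  linear_combination h - hermForm n H v u * ha

/-- The eigenvalues of a unitary matrix are permuted by `x ↦ x ^ (-n)`. -/
theorem isRoot_charpoly_pow_inv [Finite F] (hF : Nat.card F = n ^ 2) (hH : IsNondegHermitian n H)
    {A : Matrix (Fin 3) (Fin 3) F} (hdet : A.det = 1)
    (hA : ∀ v w : Fin 3 → F, hermForm n H (A.mulVec v) (A.mulVec w) = hermForm n H v w)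
    {K : Type*} [Field K] [Algebra F K] {x : K}
    (hx : (A.charpoly.map (algebraMap F K)).IsRoot x) :
    (A.charpoly.map (algebraMap F K)).IsRoot (x ^ n)⁻¹ := by
  obtain ⟨σ, hσ⟩ := exists_ringHom_apply_eq_pow hF F
  obtain ⟨τ, hτ⟩ := exists_ringHom_apply_eq_pow hF K
  have hAH : (A.map σ).transpose * H * A = H := by
    ext i j
    have h := hA (Pi.single i 1) (Pi.single j 1)
    have e : ∀ M : Matrix (Fin 3) (Fin 3) F, ∀ v w : Fin 3 → F,
        hermForm n M v w = dotProduct (σ ∘ v) (M.mulVec w) := by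
      intro M v w
      simp only [hermForm, dotProduct, Matrix.mulVec, Finset.mul_sum, Function.comp, hσ, mul_assoc]
    have es : ∀ k : Fin 3, (σ ∘ (Pi.single k 1 : Fin 3 → F)) = Pi.single k 1 := by
      intro k
      ext l
      by_cases h : l = k
      · subst h; simp
      · simp [h]
    rw [e, e, es] at h
    simp only [Matrix.mulVec_single_one, single_one_dotProduct, Matrix.col_apply] at h
    rw [← h, Matrix.mul_assoc, Matrix.mul_apply]
    rfl
  set ι := algebraMap F K
  have hroot : ∀ y : K, (A.charpoly.map ι).IsRoot y ↔
      (Matrix.scalar (Fin 3) y - A.map ι).det = 0 := by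
    intro y
    rw [← Matrix.charpoly_map, Polynomial.IsRoot.def, Matrix.eval_charpoly]
  rw [hroot] at hx ⊢
  have hx0 : x ≠ 0 := by
    rintro rfl
    rw [map_zero, zero_sub, Matrix.det_neg, ← RingHom.mapMatrix_apply, ← RingHom.map_det, hdet,
      map_one] at hx
    simp at hx
  have hστ : ∀ y, ι (σ y) = τ (ι y) := fun y => by rw [hσ, hτ, map_pow]
  -- Conjugating det(x - A) = 0 shows that x^n is an eigenvalue of the conjugate transpose; the
  -- identity `h3` below transfers this singularity to x^(-n) - A.
  have h1 : (Matrix.scalar (Fin 3) (x ^ n) - ((A.map σ).transpose).map ι).det = 0 := by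
    have h := congrArg τ hx
    rw [map_zero, RingHom.map_det] at h
    rw [← h, ← Matrix.det_transpose]
    congr 1
    ext i j
    by_cases hij : i = j
    · subst hij
      simp [hστ, ← hτ]
    · simp [hστ, hij, Ne.symm hij]
  have h2 := congrArg (Matrix.map · ι) hAH
  simp only [Matrix.map_mul] at h2
  have h3 : (Matrix.scalar (Fin 3) (x ^ n) - ((A.map σ).transpose).map ι) * (H.map ι * A.map ι) =
      H.map ι * (-(x ^ n) • (Matrix.scalar (Fin 3) (x ^ n)⁻¹ - A.map ι)) := by
    have e : -(x ^ n) • (Matrix.scalar (Fin 3) (x ^ n)⁻¹ - A.map ι) = x ^ n • A.map ι - 1 := by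
      rw [smul_sub, Matrix.scalar_apply, ← Matrix.smul_one_eq_diagonal, smul_smul, neg_mul,
        mul_inv_cancel₀ (pow_ne_zero n hx0)]
      module
    rw [sub_mul, ← Matrix.mul_assoc (((A.map σ).transpose).map ι), h2, e, mul_sub, mul_one,
      Matrix.scalar_apply, ← Matrix.smul_one_eq_diagonal, Matrix.smul_mul, one_mul,
      Matrix.mul_smul]
  have h4 := congrArg Matrix.det h3
  rw [Matrix.det_mul, h1, zero_mul, Matrix.det_mul, Matrix.det_smul] at h4
  have hH0 : (H.map ι).det ≠ 0 := by
    rw [← RingHom.mapMatrix_apply, ← RingHom.map_det]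
    exact (map_ne_zero ι).2 hH.isUnit_det.ne_zero
  have h5 := (mul_eq_zero.1 h4.symm).resolve_left hH0
  exact (mul_eq_zero.1 h5).resolve_left (pow_ne_zero _ (neg_ne_zero.2 (pow_ne_zero n hx0)))

end HermForm

/-! ### Scalar powers from the eigenvalues -/

open Polynomial in
/-- If the characteristic roots of `A` are distinct and have the same `d`-th power, then `A ^ d`
is scalar. -/
theorem pow_eq_scalar_of_roots {F : Type*} [Field F] {K : Type*} [Field K] [Algebra F K]
    {A : Matrix (Fin 3) (Fin 3) F} {a b c : K} (hab : a ≠ b) (hac : a ≠ c) (hbc : b ≠ c)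
    (hroots : A.charpoly.map (algebraMap F K) = (X - C a) * (X - C b) * (X - C c))
    {d : ℕ} {z : K} (ha : a ^ d = z) (hb : b ^ d = z) (hc : c ^ d = z) :
    ∃ r : F, algebraMap F K r = z ∧ A ^ d = Matrix.scalar _ r := by
  have hcop : ∀ {x y : K}, x ≠ y → IsCoprime (X - C x) (X - C y) := fun h =>
    isCoprime_X_sub_C_of_isUnit_sub (sub_ne_zero.2 h).isUnit
  have hr : ∀ {x : K}, x ^ d = z → X - C x ∣ X ^ d - C z := fun h => by
    rw [dvd_iff_isRoot]; simp [h]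
  -- Distinct roots make the linear factors coprime, so the characteristic polynomial divides X^d -
  -- z and Cayley–Hamilton applies.
  have hdvd : (X - C a) * (X - C b) * (X - C c) ∣ X ^ d - C z :=
    IsCoprime.mul_dvd ((hcop hac).mul_left (hcop hbc)) ((hcop hab).mul_dvd (hr ha) (hr hb)) (hr hc)
  obtain ⟨q, hq⟩ := hdvd
  have h : (A.map (algebraMap F K)) ^ d - Matrix.scalar _ z = 0 := by
    have h1 := congrArg (aeval (A.map (algebraMap F K))) hq
    rw [← hroots, ← Matrix.charpoly_map, map_mul, Matrix.aeval_self_charpoly, zero_mul, map_sub,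
      map_pow, aeval_X, aeval_C] at h1
    exact h1
  rw [sub_eq_zero, ← Matrix.map_pow] at h
  have he : ∀ i j, algebraMap F K ((A ^ d) i j) = Matrix.scalar (Fin 3) z i j := fun i j => by
    rw [← h]; rfl
  have h0 : algebraMap F K ((A ^ d) 0 0) = z := by simpa using he 0 0
  refine ⟨(A ^ d) 0 0, h0, ?_⟩
  ext i j
  apply (algebraMap F K).injective
  rw [he, ← h0]
  by_cases hij : i = j
  · subst hij; simp
  · simp [hij]

theorem exists_eigenvector_of_isRoot {F : Type*} [Field F] {A : Matrix (Fin 3) (Fin 3) F} {a : F}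
    (ha : A.charpoly.IsRoot a) : ∃ v ≠ 0, A.mulVec v = a • v := by
  rw [Polynomial.IsRoot.def, Matrix.eval_charpoly] at ha
  obtain ⟨v, hv, h⟩ := Matrix.exists_mulVec_eq_zero_iff.2 ha
  refine ⟨v, hv, ?_⟩
  rw [Matrix.sub_mulVec, sub_eq_zero] at h
  rw [← h]
  simp [Matrix.smul_mulVec, ← Matrix.smul_one_eq_diagonal]

open Polynomial in
/-- A unitary matrix without isotropic eigenvectors whose eigenvalues lie in the ground field has
order dividing `n + 1`. -/
theorem pow_succ_eq_scalar {F : Type*} [Field F] [Finite F] {n : ℕ} {H : Matrix (Fin 3) (Fin 3) F}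
    (hn : 1 < n) (hF : Nat.card F = n ^ 2) (hH : IsNondegHermitian n H)
    {A : Matrix (Fin 3) (Fin 3) F}
    (hA : ∀ v w : Fin 3 → F, hermForm n H (A.mulVec v) (A.mulVec w) = hermForm n H v w)
    (hiso : ∀ v ≠ 0, ∀ c : F, A.mulVec v = c • v → hermForm n H v v ≠ 0) {a b c : F}
    (hroots : A.charpoly = (X - C a) * (X - C b) * (X - C c)) :
    ∃ r : F, A ^ (n + 1) = Matrix.scalar _ r := by
  have hCH := Matrix.aeval_self_charpoly A
  have hne : ∀ {x y z : F}, A.charpoly = (X - C x) * (X - C y) * (X - C z) → x ≠ y := by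
    rintro x y z h rfl
    have h1 := hCH
    rw [h, map_mul, map_mul, map_sub, map_sub, aeval_X, aeval_C, aeval_C] at h1
    obtain ⟨v, hv0, hv, k, hk⟩ := exists_isotropic_eigenvector hn hF hH A x z (by
      -- Absence of Jordan blocks reduces (A - x)²(A - z) = 0 to (A - x)(A - z) = 0, column by
      -- column.
      refine Matrix.ext_of_mulVec_single fun i => ?_
      rw [← Matrix.mulVec_mulVec, Matrix.zero_mulVec]
      apply sub_scalar_mulVec_eq_zero hA hiso
      rw [Matrix.mulVec_mulVec, Matrix.mulVec_mulVec]
      have h2 : (A - Matrix.scalar _ x) * (A - Matrix.scalar _ x) * (A - Matrix.scalar _ z) = 0 :=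
        h1
      rw [h2, Matrix.zero_mulVec])
    exact hiso v hv0 k hk hv
  have hab : a ≠ b := hne hroots
  have hac : a ≠ c := hne (hroots.trans (by ring : _ = (X - C a) * (X - C c) * (X - C b)))
  have hbc : b ≠ c := hne (hroots.trans (by ring : _ = (X - C b) * (X - C c) * (X - C a)))
  have hpow : ∀ {x : F}, A.charpoly.IsRoot x → x ^ (n + 1) = 1 := by
    intro x hx
    obtain ⟨v, hv, h⟩ := exists_eigenvector_of_isRoot hx
    exact eigenvalue_pow_succ_eq_one hA (hiso v hv x h) h
  obtain ⟨r, -, hr⟩ := pow_eq_scalar_of_roots (F := F) (K := F) (A := A) hab hac hbc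
    (by rw [Algebra.algebraMap_self, Polynomial.map_id, hroots])
    (hpow (by simp [hroots])) (hpow (by simp [hroots])) (hpow (by simp [hroots]))
  exact ⟨r, hr⟩

open Polynomial in
/-- If some eigenvalue of a unitary matrix of determinant one lies outside the ground field, then
the order of the matrix modulo scalars divides `(n ^ 2 - n + 1) / gcd (3, n + 1)`; otherwise its
characteristic polynomial splits. -/
theorem pow_eq_scalar_or_charpoly_splits {F : Type*} [Field F] [Finite F] {n : ℕ}
    {H : Matrix (Fin 3) (Fin 3) F} (hn : 1 < n) (hF : Nat.card F = n ^ 2)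
    (hH : IsNondegHermitian n H) {A : Matrix (Fin 3) (Fin 3) F} (hdet : A.det = 1)
    (hA : ∀ v w : Fin 3 → F, hermForm n H (A.mulVec v) (A.mulVec w) = hermForm n H v w) :
    (∃ r : F, A ^ ((n ^ 2 - n + 1) / Nat.gcd 3 (n + 1)) = Matrix.scalar _ r) ∨
      ∃ a b c : F, A.charpoly = (X - C a) * (X - C b) * (X - C c) := by
  let K := AlgebraicClosure F
  obtain ⟨τ, hτ⟩ := exists_ringHom_apply_eq_pow hF K
  set f : K[X] := A.charpoly.map (algebraMap F K) with hf
  have hmon : f.Monic := (Matrix.charpoly_monic A).map _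
  have hsplit : f.Splits := IsAlgClosed.splits f
  have hcard : f.roots.card = 3 := by
    rw [← hsplit.natDegree_eq_card_roots, hf, natDegree_map, Matrix.charpoly_natDegree_eq_dim,
      Fintype.card_fin]
  have hfac : ∀ a b c : K, f.roots = {a, b, c} → f = (X - C a) * (X - C b) * (X - C c) := by
    intro a b c h
    rw [hsplit.eq_prod_roots_of_monic hmon, h]
    simp [mul_assoc]
  have hmem : ∀ {x : K}, x ∈ f.roots ↔ f.IsRoot x := mem_roots hmon.ne_zero
  have hφφ : ∀ x : K, (((x ^ n)⁻¹) ^ n)⁻¹ = (x ^ n) ^ n := fun x => by rw [inv_pow, inv_inv]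
  have hinj : ∀ {x y : K}, (x ^ n)⁻¹ = (y ^ n)⁻¹ → x = y := fun {x y} h => τ.injective (by
    rw [hτ, hτ]; exact inv_injective h)
  have hroot : ∀ {x : K}, x ∈ f.roots → (x ^ n)⁻¹ ∈ f.roots := fun h =>
    hmem.2 (isRoot_charpoly_pow_inv hF hH hdet hA (hmem.1 h))
  by_cases hex : ∃ x ∈ f.roots, (x ^ n) ^ n ≠ x
  · left
    obtain ⟨x, hx, hxn⟩ := hex
    set y := (x ^ n)⁻¹ with hy
    have hyr := hroot hx
    have hzr := hroot hyr
    have hz : (y ^ n)⁻¹ = (x ^ n) ^ n := hφφ x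
    rw [← hy] at hyr hzr
    have hxz : x ≠ (y ^ n)⁻¹ := by rw [hz]; exact hxn.symm
    have hxy : x ≠ y := fun h => hxz (by rw [← h]; exact h)
    have hyz : y ≠ (y ^ n)⁻¹ := fun h => hxy (hinj h)
    have hr : f.roots = {x, y, (y ^ n)⁻¹} := by
      symm
      refine Multiset.eq_of_le_of_card_le ((Multiset.le_iff_subset ?_).2 ?_) (by rw [hcard]; simp)
      · simp [hxy, hxz, hyz]
      · intro w hw
        simp only [Multiset.insert_eq_cons, Multiset.mem_cons, Multiset.mem_singleton] at hw
        rcases hw with rfl | rfl | rfl <;> assumption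
    have hfac' := hfac _ _ _ hr
    have hx0 : x ≠ 0 := by
      rintro rfl
      exact hxn (by rw [zero_pow (by omega), zero_pow (by omega)])
    have hprod : x * y * (y ^ n)⁻¹ = 1 := by
      have h := congrArg (Polynomial.eval 0) hfac'
      rw [hf, ← Matrix.charpoly_map, Matrix.eval_charpoly, map_zero, zero_sub, Matrix.det_neg,
        ← RingHom.mapMatrix_apply, ← RingHom.map_det, hdet, map_one] at h
      simp only [eval_mul, eval_sub, eval_X, eval_C, Fintype.card_fin] at h
      linear_combination h
    set d := Nat.gcd 3 (n + 1) with hd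
    have hd1 : d ∣ n + 1 := Nat.gcd_dvd_right _ _
    have hnn : n ≤ n ^ 2 := Nat.le_self_pow two_ne_zero n
    have hd2 : d ∣ n ^ 2 - n + 1 := by
      have h3 : n ^ 2 - n + 1 + 3 * n = (n + 1) * (n + 1) := by zify [hnn]; ring
      exact (Nat.dvd_add_left ((Nat.gcd_dvd_left _ _).mul_right n)).1
        (h3 ▸ hd1.mul_right (n + 1))
    obtain ⟨e, he⟩ := hd2
    have hd0 : 0 < d := Nat.gcd_pos_of_pos_left _ (by norm_num)
    rw [he, Nat.mul_div_cancel_left e hd0]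
    -- The determinant relation is x · x^(-n) · x^(n²) = 1.
    have hxm : x ^ (n ^ 2 - n + 1) = 1 := by
      have hi : y * x ^ n = 1 := inv_mul_cancel₀ (pow_ne_zero n hx0)
      rw [hz] at hprod
      clear_value y
      have h1 : x ^ (n ^ 2 - n + 1) * x ^ n = 1 * x ^ n := by
        rw [← pow_add, show n ^ 2 - n + 1 + n = n * n + 1 by rw [← sq]; omega, pow_succ, pow_mul,
          one_mul]
        linear_combination x ^ n * hprod - x * (x ^ n) ^ n * hi
      exact mul_right_cancel₀ (pow_ne_zero n hx0) h1
    -- e(n+1) is a multiple of n²-n+1 because gcd(3, n+1) divides n+1. Hence φ fixes x^e, and φ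
    -- commutes with e-th powers.
    have hz1 : (x ^ e) ^ (n + 1) = 1 := by
      obtain ⟨k, hk⟩ := hd1
      rw [hk, ← pow_mul, ← mul_assoc, mul_comm e, ← he, pow_mul, hxm, one_pow]
    have hfix : ((x ^ e) ^ n)⁻¹ = x ^ e := by
      exact inv_eq_of_mul_eq_one_right (by rw [← pow_succ, hz1])
    have hye : y ^ e = x ^ e := by
      rw [hy, inv_pow, ← pow_mul, mul_comm, pow_mul, hfix]
    have hze : ((y ^ n)⁻¹) ^ e = x ^ e := by
      rw [inv_pow, ← pow_mul, mul_comm, pow_mul, hye, hfix]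
    obtain ⟨r, -, h⟩ := pow_eq_scalar_of_roots hxy hxz hyz hfac' rfl hye hze
    exact ⟨r, h⟩
  · right
    push Not at hex
    obtain ⟨x, y, z, hr⟩ := Multiset.card_eq_three.1 hcard
    have hF' : ∀ w ∈ f.roots, ∃ a : F, algebraMap F K a = w := fun w hw =>
      mem_range_algebraMap_of_pow_card_eq hn hF (hex w hw)
    obtain ⟨a, rfl⟩ := hF' x (by simp [hr])
    obtain ⟨b, rfl⟩ := hF' y (by simp [hr])
    obtain ⟨c, rfl⟩ := hF' z (by simp [hr])
    refine ⟨a, b, c, map_injective _ (algebraMap F K).injective ?_⟩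
    rw [← hf, hfac _ _ _ hr]
    simp

/-! ### Passage to projectivities -/

section ProjectiveAction

variable {F : Type*} [Field F]

theorem toPGL_pow_eq_one_iff {A : SL(3, F)} {d : ℕ} :
    Matrix.SpecialLinearGroup.toPGL A ^ d = 1 ↔ ∃ r : F, A.1 ^ d = Matrix.scalar _ r := by
  rw [← map_pow, ← MonoidHom.mem_ker, Matrix.SpecialLinearGroup.toPGL_ker,
    Matrix.SpecialLinearGroup.mem_center_iff]
  constructor
  · rintro ⟨r, -, h⟩
    exact ⟨r, by rw [h]; simp⟩
  · rintro ⟨r, h⟩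
    refine ⟨r, ?_, by rw [← h]; simp⟩
    -- Determinant one forces r³ = 1, as the description of the centre of SL(3, F) requires.
    have h1 := congrArg Matrix.det h
    rw [Matrix.det_pow, A.2, one_pow, Matrix.scalar_apply, Matrix.det_diagonal] at h1
    simpa using h1.symm

theorem toPGL_smul_mk_eq {A : SL(3, F)} {v : Fin 3 → F} (hv : v ≠ 0) {c : F}
    (hc : A.1.mulVec v = c • v) :
    Matrix.SpecialLinearGroup.toPGL A • Projectivization.mk F v hv =
      Projectivization.mk F v hv := by
  exact (Projectivization.mk_eq_mk_iff' F (A.1.mulVec v) v _ hv).2 ⟨c, hc.symm⟩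

end ProjectiveAction

/-! ### Orders of cyclic semiregular subgroups -/

theorem mainTheorem2 {F : Type*} [Field F] [Finite F] (n : ℕ) (hn : 3 ≤ n) (hodd : Odd n)
    (hF : Nat.card F = n ^ 2) (H : Matrix (Fin 3) (Fin 3) F) (hH : IsNondegHermitian n H)
    (U : Subgroup (projSpecialUnitary n H)) (hcyc : IsCyclic U)
    (hU : ∀ g ∈ U, g ≠ 1 → ∀ P ∈ unital n H, (g : PGL(Fin 3, F)) • P ≠ P) :
    Nat.card U ∣ (n + 1) / 2 ∨ Nat.card U ∣ (n ^ 2 - n + 1) / Nat.gcd 3 (n + 1) := by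
  obtain ⟨⟨g, hgU⟩, hg⟩ := hcyc.exists_generator
  obtain ⟨A, hA, hAg⟩ := g.2
  rw [← orderOf_eq_card_of_forall_mem_zpowers hg, Subgroup.orderOf_mk]
  have hpow : ∀ {d : ℕ}, g ^ d = 1 ↔ ∃ r : F, A.1 ^ d = Matrix.scalar _ r := by
    intro d
    rw [← toPGL_pow_eq_one_iff (A := A), hAg, ← Subgroup.coe_pow, OneMemClass.coe_eq_one]
  have hiso : ∀ k : ℕ, g ^ k ≠ 1 → ∀ v ≠ 0, ∀ c : F, (A.1 ^ k).mulVec v = c • v →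
      hermForm n H v v ≠ 0 := by
    intro k hk v hv c hc h
    refine hU (g ^ k) (U.pow_mem hgU k) hk (Projectivization.mk F v hv)
      ((mk_mem_unital n H v hv).2 h) ?_
    rw [Subgroup.coe_pow, ← hAg, ← map_pow]
    exact toPGL_smul_mk_eq hv (c := c) (by simpa using hc)
  rcases eq_or_ne g 1 with rfl | hg1
  · left
    simp
  rcases pow_eq_scalar_or_charpoly_splits (by omega) hF hH A.2 hA with h | ⟨a, b, c, hroots⟩
  · right
    exact orderOf_dvd_of_pow_eq_one (hpow.2 h)
  left
  have h1 : orderOf g ∣ n + 1 := orderOf_dvd_of_pow_eq_one (hpow.2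
    (pow_succ_eq_scalar (by omega) hF hH hA (by simpa using hiso 1 (by simpa using hg1)) hroots))
  have h2 : ¬ 2 ∣ orderOf g := by
    rintro ⟨k, hk⟩
    have hpos : 0 < orderOf g := Nat.pos_of_dvd_of_pos h1 (by omega)
    have hk1 : g ^ k ≠ 1 := pow_ne_one_of_lt_orderOf (by omega) (by omega)
    obtain ⟨r, hr⟩ := hpow.1 (pow_orderOf_eq_one g)
    obtain ⟨v, hv, hav⟩ := exists_eigenvector_of_isRoot (A := A.1) (a := a) (by simp [hroots])
    have hvk : ∀ m : ℕ, (A.1 ^ m).mulVec v = a ^ m • v := by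
      intro m
      induction m with
      | zero => simp
      | succ m ih => rw [pow_succ, ← Matrix.mulVec_mulVec, hav, Matrix.mulVec_smul, ih, smul_smul,
          pow_succ']
    -- An eigenvector identifies the scalar as a^(2k), a square in `F`, so (A^k - a^k)(A^k + a^k) =
    -- 0.
    have hra : r = a ^ orderOf g := by
      have h := hvk (orderOf g)
      rw [hr, Matrix.scalar_apply, ← Matrix.smul_one_eq_diagonal, Matrix.smul_mulVec,
        Matrix.one_mulVec] at h
      exact smul_left_injective F hv h
    obtain ⟨w, hw, hww, c, hc⟩ := exists_isotropic_eigenvector (by omega) hF hH (A.1 ^ k) (a ^ k)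
      (-(a ^ k)) (by
        have hcomm := (Matrix.scalar_commute (a ^ k) (Commute.all _) (A.1 ^ k)).symm
        rw [map_neg, sub_neg_eq_add, ← hcomm.mul_self_sub_mul_self_eq', ← pow_add, ← two_mul,
          ← hk, hr, hra, ← map_mul, ← pow_add, ← two_mul, ← hk, sub_self])
    exact hiso k hk1 w hw c hc hww
  obtain ⟨m, hm⟩ := hodd
  have h3 : n + 1 = 2 * ((n + 1) / 2) := by omega
  rw [h3] at h1
  exact ((Nat.Prime.coprime_iff_not_dvd Nat.prime_two).2 h2).symm.dvd_of_dvd_mul_left h1
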